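/- Let $r, n \ge 1$ be integers and let $d \mid r$, $p = r/d$. Let $C_r \subset \mathbb{C}^\times$ be the group of $r$-th roots of unity, let $G(r,1,n) = C_r^n \rtimes S_n$ with $\sigma(\xi_1,\dots,\xi_n) = (\xi_{\sigma^{-1}(1)},\dots,\xi_{\sigma^{-1}(n)})$, let $G(r,d,n)$ be the kernel of $G(r,1,n) \to C_r$, $(\xi_1,\dots,\xi_n,\sigma) \mapsto (\xi_1\cdots\xi_n)^p$, and regard $S_n$ as the subgroup $\{(1,\dots,1,\sigma)\}$ of $G(r,d,n)$. Let $G(r,1,n)$ act on $\mathbb{C}[x_1,\dots,x_n]$ by $((\xi_1,\dots,\xi_n,\sigma)f)(x_1,\dots,x_n) = f(\xi_{\sigma(1)}^{-1}x_{\sigma(1)},\dots,\xi_{\sigma(n)}^{-1}x_{\sigma(n)})$. Let $k = (k_0,\dots,k_{r-1}) \in \mathbb{N}^r$ with $\sum_i k_i = n$, let $\lambda = (\lambda_1,\dots,\lambda_n)$ be the weakly increasing sequence in which each $i \in \{0,\dots,r-1\}$ occurs $k_i$ times, let $M = \{x_{\sigma(1)}^{\lambda_1}\cdots x_{\sigma(n)}^{\lambda_n}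 : \sigma \in S_n\}$ (a set of monomials), and let $V^k = \bigoplus_{f\in M}\mathbb{C}f$, a $G(r,1,n)$-module. Put $w = \sum_{f \in M} f \in V^k$ and $W^k = \mathbb{C}[G(r,d,n)]\,w \subseteq V^k$. Let $\Gamma \le S_r$ be the subgroup generated by $(0\ 1\ \dots\ r-1)^p$, acting on such tuples by $\sigma(k_0,\dots,k_{r-1}) = (k_{\sigma^{-1}(0)},\dots,k_{\sigma^{-1}(r-1)})$, and let $\Gamma_k$ be the stabilizer of $k$ in $\Gamma$. Then $w$ is $S_n$-invariant, $W^k$ is an irreducible $G(r,d,n)$-module isomorphic to a submodule of the induced module $1_{S_n}^{G(r,d,n)}$, and $$\dim W^k = \frac{\dim V^k}{|\Gamma_k|} = |\Gamma_k|^{-1}\binom{n}{k_0,\dots,k_{r-1}}.$$ -/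

import Mathlib

noncomputable section

namespace ComplexReflection

open MvPolynomial

/-- The wreath product `G(r,1,n) = C_r ≀ S_n = C_r ^ n ⋊ S_n`, where `C_r` is the group of complex
`r`-th roots of unity and `σ (ξ₁, …, ξₙ) = (ξ_{σ⁻¹(1)}, …, ξ_{σ⁻¹(n)})`. -/
abbrev FullGroup (r n : ℕ) : Type :=
  SemidirectProduct (Fin n → rootsOfUnity r ℂ) (Equiv.Perm (Fin n)) mulAutArrow

theorem mulAutArrow_perm_apply {r n : ℕ} (σ : Equiv.Perm (Fin n))
    (z : Fin n → rootsOfUnity r ℂ) (i : Fin n) :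
    mulAutArrow σ z i = z (σ⁻¹ i) := rfl

/-- The homomorphism `(ξ₁, …, ξₙ, σ) ↦ (ξ₁ ⋯ ξₙ) ^ (r / d)`, whose values lie in
`C_d ⊆ C_r` when `d ∣ r`. -/
def Phi (r d n : ℕ) : FullGroup r n →* rootsOfUnity r ℂ where
  toFun g := (∏ i, g.left i) ^ (r / d)
  map_one' := by simp
  map_mul' g h := by
    have key : ∏ i, mulAutArrow g.right h.left i = ∏ i, h.left i := by
      simp only [mulAutArrow_perm_apply]
      exact Equiv.prod_comp (g.right⁻¹) h.left
    simp only [SemidirectProduct.mul_left, Pi.mul_apply, Finset.prod_mul_distrib, key, mul_pow]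

/-- The complex reflection group `G(r,d,n)`, as a subgroup of `G(r,1,n)`. -/
def reflGroup (r d n : ℕ) : Subgroup (FullGroup r n) := (Phi r d n).ker

/-- The subgroup `S_n = {(1, …, 1, σ)}` of `G(r,d,n)`. -/
def symSubgroup (r d n : ℕ) : Subgroup (reflGroup r d n) :=
  (SemidirectProduct.inr : Equiv.Perm (Fin n) →* FullGroup r n).range.subgroupOf (reflGroup r d n)

/-- The action of `G(r,1,n)` on polynomials in `n` variables,
`((ξ₁, …, ξₙ, σ) f)(x₁, …, xₙ) = f (ξ_{σ(1)}⁻¹ x_{σ(1)}, …, ξ_{σ(n)}⁻¹ x_{σ(n)})`. -/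
def polyRep (r n : ℕ) : Representation ℂ (FullGroup r n) (MvPolynomial (Fin n) ℂ) where
  toFun g := (aeval fun i : Fin n =>
    C (((g.left (g.right i) : ℂˣ) : ℂ)⁻¹) * X (g.right i) :
      MvPolynomial (Fin n) ℂ →ₐ[ℂ] MvPolynomial (Fin n) ℂ).toLinearMap
  map_one' := by
    have h : (aeval fun i : Fin n => (X i : MvPolynomial (Fin n) ℂ)) = AlgHom.id ℂ _ :=
      aeval_X_left
    change (aeval fun i : Fin n =>
      C ((((1 : rootsOfUnity r ℂ) : ℂˣ) : ℂ)⁻¹) * (X i : MvPolynomial (Fin n) ℂ)).toLinearMap = 1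
    simp only [OneMemClass.coe_one, Units.val_one, inv_one, map_one, one_mul, h]
    rfl
  map_mul' g h := by
    rw [Module.End.mul_eq_comp, ← AlgHom.comp_toLinearMap]
    congr 1
    ext1 i
    simp only [aeval_X, AlgHom.comp_apply, map_mul, algHom_C, SemidirectProduct.mul_right,
      SemidirectProduct.mul_left, Pi.mul_apply, Equiv.Perm.mul_apply, mulAutArrow_perm_apply,
      Subgroup.coe_mul, Units.val_mul, mul_inv, algebraMap_eq]
    rw [show g.right⁻¹ (g.right (h.right i)) = h.right i from
      Equiv.symm_apply_apply g.right (h.right i)]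
    ring

/-- The set `X_n^{r-1}` of `r`-tuples of natural numbers with sum `n`. -/
def Tuples (r n : ℕ) : Type := {k : Fin r → ℕ // ∑ i, k i = n}

/-- `S_r` acts on `r`-tuples by `σ (k_0, …, k_{r-1}) = (k_{σ⁻¹(0)}, …, k_{σ⁻¹(r-1)})`. -/
instance (r n : ℕ) : MulAction (Equiv.Perm (Fin r)) (Tuples r n) where
  smul σ k := ⟨fun i => k.1 (σ⁻¹ i), (Equiv.sum_comp σ⁻¹ k.1).trans k.2⟩
  one_smul _ := rfl
  mul_smul _ _ _ := rfl

/-- The group `Γ`, generated by the `(r / d)`-th power of the cycle `(0 1 … r-1)`. -/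
def Gam (r d : ℕ) : Subgroup (Equiv.Perm (Fin r)) :=
  Subgroup.zpowers (finRotate r ^ (r / d))

/-- The stabilizer `Γ_k` of `k` in `Γ`. -/
def gamStab {r n : ℕ} (d : ℕ) (k : Tuples r n) : Subgroup (Gam r d) :=
  MulAction.stabilizer (Gam r d) k

/-- The weakly increasing sequence `(0, …, 0, …, r-1, …, r-1)` in which `i` occurs `k i` times. -/
def psi {r : ℕ} (k : Fin r → ℕ) : List ℕ :=
  (List.finRange r).flatMap fun i => List.replicate (k i) (i : ℕ)

theorem length_psi {r n : ℕ} (k : Tuples r n) : (psi k.1).length = n := by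
  refine Eq.trans ?_ k.2
  simp [psi, List.length_flatMap, Fin.sum_univ_def]

/-- `psi k` as an `n`-tuple. -/
def psiTuple {r n : ℕ} (k : Tuples r n) (i : Fin n) : ℕ :=
  (psi k.1).get (i.cast (length_psi k).symm)

/-- The monomial `x_{σ(1)}^{l_1} ⋯ x_{σ(n)}^{l_n}`. -/
def permMonomial {n : ℕ} (l : Fin n → ℕ) (σ : Equiv.Perm (Fin n)) : MvPolynomial (Fin n) ℂ :=
  ∏ i, X (σ i) ^ l i

open Classical in
/-- The set of monomials `M_n(l) = {x_{σ(1)}^{l_1} ⋯ x_{σ(n)}^{l_n} | σ ∈ S_n}`. -/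
def monomials {n : ℕ} (l : Fin n → ℕ) : Finset (MvPolynomial (Fin n) ℂ) :=
  Finset.univ.image (permMonomial l)

theorem polyRep_permMonomial {r n : ℕ} (g : FullGroup r n) (l : Fin n → ℕ)
    (σ : Equiv.Perm (Fin n)) :
    polyRep r n g (permMonomial l σ) =
      (∏ i, (((g.left (g.right (σ i)) : ℂˣ) : ℂ)⁻¹) ^ l i) • permMonomial l (g.right * σ) := by
  simp only [polyRep, permMonomial, MonoidHom.coe_mk, OneHom.coe_mk, AlgHom.toLinearMap_apply,
    map_prod, map_pow, aeval_X, mul_pow, Finset.prod_mul_distrib, Equiv.Perm.mul_apply,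
    smul_eq_C_mul]

/-- The `G(r,1,n)`-module `V^k`: the span of the monomials in `M_n(psi k)`. -/
def V {r n : ℕ} (k : Tuples r n) : Subrepresentation (polyRep r n) where
  toSubmodule := Submodule.span ℂ (monomials (psiTuple k) : Set (MvPolynomial (Fin n) ℂ))
  apply_mem_toSubmodule g v hv := by
    induction hv using Submodule.span_induction with
    | mem x hx =>
      obtain ⟨σ, -, rfl⟩ := Finset.mem_image.1 (Finset.mem_coe.1 hx)
      rw [polyRep_permMonomial]
      exact Submodule.smul_mem _ _ (Submodule.subset_span
        (Finset.mem_coe.2 (Finset.mem_image_of_mem _ (Finset.mem_univ _))))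
    | zero => simp
    | add x y _ _ hx hy => rw [map_add]; exact Submodule.add_mem _ hx hy
    | smul c x _ hx => rw [map_smul]; exact Submodule.smul_mem _ _ hx

/-- The restriction of the representation `V^k` to `G(r,d,n)`. -/
def resV {r n : ℕ} (d : ℕ) (k : Tuples r n) :
    Representation ℂ (reflGroup r d n) (V k).toSubmodule :=
  (V k).toRepresentation.comp (reflGroup r d n).subtype

/-- The vector `w`, the sum of the monomials in `M_n(psi k)`, as an element of `V^k`. -/
def w {r n : ℕ} (k : Tuples r n) : (V k).toSubmodule :=
  ⟨∑ f ∈ monomials (psiTuple k), f, Submodule.sum_mem _ fun _ hf => Submodule.subset_span hf⟩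

/-- The `G(r,d,n)`-module `W^k = ℂ[G(r,d,n)] w`. -/
def W {r n : ℕ} (d : ℕ) (k : Tuples r n) : Subrepresentation (resV d k) where
  toSubmodule := Submodule.span ℂ (Set.range fun g : reflGroup r d n => resV d k g (w k))
  apply_mem_toSubmodule g v hv := by
    induction hv using Submodule.span_induction with
    | mem x hx =>
      obtain ⟨h, rfl⟩ := hx
      refine Submodule.subset_span ⟨g * h, ?_⟩
      simp only [map_mul, Module.End.mul_apply]
    | zero => simp
    | add x y _ _ hx hy => rw [map_add]; exact Submodule.add_mem _ hx hy
    | smul c x _ hx => rw [map_smul]; exact Submodule.smul_mem _ _ hx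

/-- The induced representation `1_{S_n}^{G(r,d,n)}`. -/
def indTriv (r d n : ℕ) :
    Representation ℂ (reflGroup r d n)
      (Representation.IndV (symSubgroup r d n).subtype
        (Representation.trivial ℂ (symSubgroup r d n) ℂ)) :=
  Representation.ind (symSubgroup r d n).subtype
    (Representation.trivial ℂ (symSubgroup r d n) ℂ)

end ComplexReflection

end

/-! The monomials in `V k` correspond to words of length n in which the letter i occurs k_i times.
The diagonal subgroup D of G(r,d,n) acts on each of them through a character, S_n permutes them
transitively, and w is their sum.

As S_n fixes w, the G-orbit of w is its D-orbit. Projecting w to the isotypic components of D shows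
that W is spanned by the class sums, one for each character that occurs: the sum of all monomials
with that character. So dim W counts these characters (`finrank_span_orbit`). A nonzero submodule
contains some class sum, and permuting and projecting then yields every other one, so W is
irreducible (`eq_of_le_span_orbit`). An irreducible module with a nonzero S_n-fixed vector embeds in
the induced module (`exists_injective_intertwiningMap_ind`).

Finally, two words have the same character exactly when an element of Γ_k rotates the letters of one
into the other. This action is free, so every class has |Γ_k| words (`card_range_wordChar_mul`), and
the words are counted by a multinomial coefficient. -/

namespace ComplexReflection

/-! ### Orbit of a sum of eigenvectors of a finite abelian group -/

section Diagonal

variable {K G D E V : Type*} [Field K] [Group G] [CommGroup D] [Fintype D]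
  [AddCommGroup V] [Module K V]

/-- The projection onto the `ψ`-isotypic part of a representation of a finite abelian group. -/
noncomputable def isotypicProj (σ : Representation K D V) (ψ : D →* K) : V →ₗ[K] V :=
  (Fintype.card D : K)⁻¹ • ∑ a, ψ a⁻¹ • σ a

theorem isotypicProj_mem {σ : Representation K D V} {U : Submodule K V}
    (hU : ∀ a, ∀ v ∈ U, σ a v ∈ U) (ψ : D →* K) {v : V} (hv : v ∈ U) :
    isotypicProj σ ψ v ∈ U := by
  simp only [isotypicProj, LinearMap.smul_apply, LinearMap.sum_apply]
  exact U.smul_mem _ (U.sum_mem fun a _ => U.smul_mem _ (hU a v hv))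

-- Orthogonality of characters: a nontrivial homomorphism from a finite group to the units of a
-- field sums to zero, and |D| is invertible in characteristic zero.
open Classical in
theorem isotypicProj_apply_of_eigen [CharZero K] {σ : Representation K D V} {χ : D →* K} {v : V}
    (h : ∀ a, σ a v = χ a • v) (ψ : D →* K) :
    isotypicProj σ ψ v = if χ = ψ then v else 0 := by
  have hcard : (Fintype.card D : K) ≠ 0 := Nat.cast_ne_zero.2 Fintype.card_ne_zero
  have key : isotypicProj σ ψ v =
      ((Fintype.card D : K)⁻¹ * ∑ a, (ψ.comp invMonoidHom * χ) a) • v := by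
    simp only [isotypicProj, LinearMap.smul_apply, LinearMap.sum_apply, h, smul_smul, ← Finset.sum_smul]
    rfl
  have hinv : ∀ a, ψ a⁻¹ * ψ a = 1 := fun a => by rw [← map_mul, inv_mul_cancel, map_one]
  rw [key]
  split_ifs with hχ
  · subst hχ
    have : ∀ a, (χ.comp invMonoidHom * χ) a = 1 := hinv
    simp [this, hcard]
  · rw [sum_hom_units_eq_zero, mul_zero, zero_smul]
    refine fun h1 => hχ (MonoidHom.ext fun a => ?_)
    have h2 : ψ a⁻¹ * χ a = 1 := DFunLike.congr_fun h1 a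
    calc χ a = (ψ a⁻¹ * ψ a) * χ a := by rw [hinv, one_mul]
      _ = ψ a * (ψ a⁻¹ * χ a) := by ring
      _ = ψ a := by rw [h2, mul_one]

open Classical in
theorem isotypicProj_sum [CharZero K] {σ : Representation K D V}
    {b : E → V} {χ : E → D →* K} (hσ : ∀ a e, σ a (b e) = χ e a • b e)
    (s : Finset E) (π : E → E) (ψ : D →* K) :
    isotypicProj σ ψ (∑ e ∈ s, b (π e)) = ∑ e ∈ s with χ (π e) = ψ, b (π e) := by
  rw [map_sum, Finset.sum_filter]
  exact Finset.sum_congr rfl fun e _ => isotypicProj_apply_of_eigen (fun a => hσ a (π e)) ψ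

theorem sum_ne_zero_of_linearIndependent {b : E → V} (hb : LinearIndependent K b) {s : Finset E}
    (hs : s.Nonempty) : ∑ e ∈ s, b e ≠ 0 := by
  intro h
  obtain ⟨e, he⟩ := hs
  have := linearIndependent_iff'.1 hb s (fun _ => 1) (by simpa using h) e he
  exact one_ne_zero this

variable [Fintype E]

open Classical in
/-- The sum of the vectors `b e` with character `ψ`. -/
noncomputable def classSum (b : E → V) (χ : E → D →* K) (ψ : D →* K) : V :=
  ∑ e with χ e = ψ, b e

theorem apply_classSum {σ : Representation K D V}
    {b : E → V} {χ : E → D →* K} (hσ : ∀ a e, σ a (b e) = χ e a • b e)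
    (ψ : D →* K) (a : D) :
    σ a (classSum b χ ψ) = ψ a • classSum b χ ψ := by
  classical
  simp only [classSum, map_sum, hσ, Finset.smul_sum]
  refine Finset.sum_congr rfl fun e he => ?_
  rw [(Finset.mem_filter.1 he).2]

open Classical in
theorem isotypicProj_classSum [CharZero K] {σ : Representation K D V}
    {b : E → V} {χ : E → D →* K} (hσ : ∀ a e, σ a (b e) = χ e a • b e)
    (φ ψ : D →* K) :
    isotypicProj σ ψ (classSum b χ φ) = if φ = ψ then classSum b χ φ else 0 :=
  isotypicProj_apply_of_eigen (apply_classSum hσ φ) ψ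

open Classical in
theorem sum_classSum {V : Type*} [AddCommGroup V] (b : E → V) (χ : E → D →* K) :
    ∑ ψ ∈ Finset.univ.image χ, classSum b χ ψ = ∑ e, b e :=
  Finset.sum_fiberwise_of_maps_to (fun e _ => Finset.mem_image_of_mem χ (Finset.mem_univ e)) b

theorem classSum_ne_zero {b : E → V} (hb : LinearIndependent K b) (χ : E → D →* K) (e : E) :
    classSum b χ (χ e) ≠ 0 :=
  sum_ne_zero_of_linearIndependent hb ⟨e, by simp⟩

variable {ρ : Representation K G V} {ι : D →* G} {b : E → V} {χ : E → D →* K}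

theorem linearIndependent_classSum [CharZero K] {σ : Representation K D V}
    (hσ : ∀ a e, σ a (b e) = χ e a • b e) (hb : LinearIndependent K b) :
    LinearIndependent K fun ψ : Set.range χ => classSum b χ ψ.1 := by
  classical
  rw [linearIndependent_iff']
  intro s g hg φ hφ
  have h := congrArg (isotypicProj σ φ.1) hg
  simp only [map_sum, map_smul, isotypicProj_classSum hσ, map_zero] at h
  rw [Finset.sum_eq_single φ (fun ψ _ hne => by
    rw [if_neg (fun h => hne (Subtype.ext h)), smul_zero]) (fun h => absurd hφ h), if_pos rfl] at h
  obtain ⟨e, he⟩ := φ.2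
  exact (smul_eq_zero.1 h).resolve_right (he ▸ classSum_ne_zero hb χ e)

/-- By `hG` only D moves the total vector, and D scales each class sum. Conversely, each class sum
is an isotypic projection of the total vector, and the projection preserves the orbit span. -/
theorem span_orbit_eq_span_classSum [CharZero K]
    (hσ : ∀ a e, ρ (ι a) (b e) = χ e a • b e)
    (hG : ∀ g, ∃ a, ρ g (∑ e, b e) = ρ (ι a) (∑ e, b e)) :
    Submodule.span K (Set.range fun g => ρ g (∑ e, b e)) =
      Submodule.span K (Set.range fun ψ : Set.range χ => classSum b χ ψ.1) := by
  classical
  apply le_antisymm <;> rw [Submodule.span_le]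
  · rintro _ ⟨g, rfl⟩
    obtain ⟨a, ha⟩ := hG g
    simp only [ha]
    rw [← sum_classSum b χ, map_sum]
    refine Submodule.sum_mem _ fun ψ hψ => ?_
    have h : ρ (ι a) (classSum b χ ψ) = ψ a • classSum b χ ψ :=
      apply_classSum (σ := ρ.comp ι) hσ ψ a
    rw [h]
    exact Submodule.smul_mem _ _ (Submodule.subset_span ⟨⟨ψ, by simpa using hψ⟩, rfl⟩)
  · rintro _ ⟨ψ, rfl⟩
    have h := isotypicProj_sum (σ := ρ.comp ι) hσ Finset.univ id ψ.1
    simp only [id] at h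
    change classSum b χ ψ.1 ∈ _
    rw [classSum, ← h]
    refine isotypicProj_mem (fun a v hv => ?_) _ (Submodule.subset_span ⟨1, by simp⟩)
    induction hv using Submodule.span_induction with
    | mem x hx =>
      obtain ⟨g, rfl⟩ := hx
      refine Submodule.subset_span ⟨ι a * g, ?_⟩
      simp
    | zero => simp
    | add x y _ _ hx hy => rw [map_add]; exact Submodule.add_mem _ hx hy
    | smul c x _ hx => rw [map_smul]; exact Submodule.smul_mem _ _ hx

theorem finrank_span_orbit [CharZero K] (hb : LinearIndependent K b)
    (hσ : ∀ a e, ρ (ι a) (b e) = χ e a • b e)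
    (hG : ∀ g, ∃ a, ρ g (∑ e, b e) = ρ (ι a) (∑ e, b e)) :
    Module.finrank K (Submodule.span K (Set.range fun g => ρ g (∑ e, b e))) =
      Nat.card (Set.range χ) := by
  classical
  rw [span_orbit_eq_span_classSum hσ hG, Nat.card_eq_fintype_card]
  exact finrank_span_eq_card (linearIndependent_classSum (σ := ρ.comp ι) hσ hb)

theorem isotypicProj_mem_span_classSum [CharZero K] {σ : Representation K D V}
    (hσ : ∀ a e, σ a (b e) = χ e a • b e) (φ : D →* K) {v : V}
    (hv : v ∈ Submodule.span K (Set.range fun ψ : Set.range χ => classSum b χ ψ.1)) :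
    isotypicProj σ φ v ∈ Submodule.span K {classSum b χ φ} := by
  classical
  induction hv using Submodule.span_induction with
  | mem x hx =>
    obtain ⟨ψ, rfl⟩ := hx
    simp only [isotypicProj_classSum hσ]
    split_ifs with h
    · rw [h]; exact Submodule.mem_span_singleton_self _
    · exact Submodule.zero_mem _
  | zero => simp
  | add x y _ _ hx hy => rw [map_add]; exact Submodule.add_mem _ hx hy
  | smul c x _ hx => rw [map_smul]; exact Submodule.smul_mem _ _ hx

open Classical in
theorem sum_isotypicProj_eq_self [CharZero K] {σ : Representation K D V}
    (hσ : ∀ a e, σ a (b e) = χ e a • b e) {v : V}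
    (hv : v ∈ Submodule.span K (Set.range fun ψ : Set.range χ => classSum b χ ψ.1)) :
    ∑ φ ∈ Finset.univ.image χ, isotypicProj σ φ v = v := by
  induction hv using Submodule.span_induction with
  | mem x hx =>
    obtain ⟨ψ, rfl⟩ := hx
    simp only [isotypicProj_classSum hσ]
    rw [Finset.sum_ite_eq, if_pos]
    obtain ⟨e, he⟩ := ψ.2
    exact he ▸ Finset.mem_image_of_mem χ (Finset.mem_univ e)
  | zero => simp
  | add x y _ _ hx hy => simp only [map_add, Finset.sum_add_distrib, hx, hy]
  | smul c x _ hx => simp only [map_smul, ← Finset.smul_sum, hx]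

/-- Inside the orbit span each isotypic component is a line spanned by a class sum, so a nonzero
projection of a vector of `U` puts that class sum in `U`. Elements permuting the basis transitively
spread this to all characters. -/
theorem eq_of_le_span_orbit [CharZero K] (hb : LinearIndependent K b)
    (hσ : ∀ a e, ρ (ι a) (b e) = χ e a • b e)
    (hG : ∀ g, ∃ a, ρ g (∑ e, b e) = ρ (ι a) (∑ e, b e))
    (htrans : ∀ e e', ∃ g, ∃ π : Equiv.Perm E, (∀ x, ρ g (b x) = b (π x)) ∧ π e = e')
    {U : Submodule K V} (hU : ∀ g, ∀ v ∈ U, ρ g v ∈ U)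
    (hUW : U ≤ Submodule.span K (Set.range fun g => ρ g (∑ e, b e))) (hne : U ≠ ⊥) :
    U = Submodule.span K (Set.range fun g => ρ g (∑ e, b e)) := by
  classical
  rw [span_orbit_eq_span_classSum hσ hG] at hUW ⊢
  refine le_antisymm hUW ?_
  have hσ' : ∀ a e, (ρ.comp ι) a (b e) = χ e a • b e := hσ
  have step : ∀ φ, ∀ v ∈ U, isotypicProj (ρ.comp ι) φ v ≠ 0 → classSum b χ φ ∈ U := by
    intro φ v hv hne
    obtain ⟨c, hc⟩ := Submodule.mem_span_singleton.1
      (isotypicProj_mem_span_classSum hσ' φ (hUW hv))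
    have hc0 : c ≠ 0 := fun h => hne (by rw [← hc, h, zero_smul])
    have hmem : isotypicProj (ρ.comp ι) φ v ∈ U :=
      isotypicProj_mem (fun a v hv => hU (ι a) v hv) φ hv
    rw [← hc] at hmem
    exact (Submodule.smul_mem_iff _ hc0).1 hmem
  obtain ⟨v, hv, hv0⟩ := Submodule.exists_mem_ne_zero_of_ne_bot hne
  obtain ⟨φ, hφ, hφv⟩ := Finset.exists_ne_zero_of_sum_ne_zero
    ((sum_isotypicProj_eq_self hσ' (hUW hv)).trans_ne hv0)
  obtain ⟨e, -, rfl⟩ := Finset.mem_image.1 hφ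
  have he := step _ v hv hφv
  rw [Submodule.span_le]
  rintro _ ⟨⟨_, e', rfl⟩, rfl⟩
  obtain ⟨g, π, hg, hπ⟩ := htrans e e'
  -- The translate by `g` is a sum of distinct basis vectors that includes `b e'`, so its `χ e'`
  -- component cannot vanish.
  refine step _ _ (hU g _ he) ?_
  have hgc : ρ g (classSum b χ (χ e)) = ∑ x with χ x = χ e, b (π x) := by
    simp only [classSum, map_sum, hg]
  rw [hgc, isotypicProj_sum hσ' _ π]
  erw [← Finset.sum_map _ π.toEmbedding b]
  refine sum_ne_zero_of_linearIndependent hb ⟨e', ?_⟩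
  exact Finset.mem_map.2 ⟨e, by simp [hπ], hπ⟩

end Diagonal

/-! ### Embedding an irreducible module in an induced module -/

section Induced

variable {K G V : Type*} [Field K] [CharZero K] [Group G] [Finite G] [AddCommGroup V] [Module K V]
  [FiniteDimensional K V]

-- A functional `l` with `l v ≠ 0` gives the equivariant map x ↦ ∑ l(gx)·[g]. By irreducibility it
-- is injective or zero; a trace computation excludes zero.
open Representation in
theorem exists_injective_intertwiningMap_ind (ρ : Representation K G V) [IsIrreducible ρ]
    (H : Subgroup G) {v : V} (hv : v ≠ 0) (hH : ∀ h ∈ H, ρ h v = v) :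
    ∃ f : IntertwiningMap ρ (ind H.subtype (trivial K H K)), Function.Injective f := by
  classical
  have := Fintype.ofFinite G
  obtain ⟨l, hl⟩ : ∃ l : Module.Dual K V, l v ≠ 0 := by
    by_contra! h
    exact hv ((Module.forall_dual_apply_eq_zero_iff K v).1 h)
  let mk (g : G) : IndV H.subtype (trivial K H K) := IndV.mk H.subtype (trivial K H K) g 1
  let f : V →ₗ[K] IndV H.subtype (trivial K H K) :=
    ∑ g, (l ∘ₗ ρ g).smulRight (mk g)
  have hf : ∀ x, f x = ∑ g, l (ρ g x) • mk g := fun x => by simp [f]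
  let F : IntertwiningMap ρ (ind H.subtype (trivial K H K)) := ⟨f, fun h => by
    ext x
    change f (ρ h x) = ind H.subtype (trivial K H K) h (f x)
    rw [hf, hf, map_sum]
    refine Fintype.sum_equiv (Equiv.mulRight h) _ _ fun g => ?_
    rw [map_smul, ind_mk]
    simp [mk]⟩
  refine ⟨F, (IsIrreducible.injective_or_eq_zero F).resolve_right fun hF => ?_⟩
  -- The map [g] ↦ g⁻¹v descends to coinvariants because H fixes v. Its composite with `f` is a sum
  -- of conjugates of the rank-one map x ↦ l(x)v, so its trace is |G|·l(v) ≠ 0.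
  let q : IndV H.subtype (trivial K H K) →ₗ[K] V :=
    Coinvariants.lift _ (TensorProduct.lift <|
      (Finsupp.lift _ _ _ fun g => LinearMap.toSpanSingleton K V (ρ g⁻¹ v)) ∘ₗ
        (MonoidAlgebra.coeffLinearEquiv K).toLinearMap) fun h => by
      ext g
      have hh : ρ (h : G)⁻¹ v = v := hH _ (H.inv_mem h.2)
      simp [hh]
  have hq : ∀ g, q (mk g) = ρ g⁻¹ v := fun g => by simp [q, mk]
  have hzero : ∑ g, ρ g⁻¹ ∘ₗ (l.smulRight v) ∘ₗ ρ g = 0 := by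
    ext x
    have : q (F x) = 0 := by rw [hF]; simp
    change q (f x) = 0 at this
    rw [hf, map_sum] at this
    simpa [hq] using this
  have htr := congrArg (LinearMap.trace K V) hzero
  have : ∀ g, LinearMap.trace K V (ρ g⁻¹ ∘ₗ (l.smulRight v) ∘ₗ ρ g) = l v := fun g => by
    rw [LinearMap.trace_comp_comm', LinearMap.comp_assoc, ← Module.End.mul_eq_comp (ρ g), ← map_mul,
      mul_inv_cancel, map_one, Module.End.one_eq_id, LinearMap.comp_id, LinearMap.trace_smulRight]
  simp [this, hl] at htr

end Induced

/-! ### Words with prescribed letter multiplicities -/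

/-- The words of length `n` in which each letter `i` occurs `k i` times. -/
abbrev Words {r n : ℕ} (k : Tuples r n) : Type :=
  {e : Fin n → Fin r // ∀ i, Fintype.card {j // e j = i} = k.1 i}

theorem exists_perm_comp_eq {α β : Type*} [Fintype α] [DecidableEq β] {f g : α → β}
    (h : ∀ i, Fintype.card {a // f a = i} = Fintype.card {a // g a = i}) :
    ∃ σ : Equiv.Perm α, g ∘ σ = f :=
  ⟨Equiv.ofFiberEquiv fun i => Fintype.equivOfCardEq (h i),
    funext fun a => Equiv.ofFiberEquiv_map _ a⟩

theorem card_fiber_comp_perm {α β : Type*} [Fintype α] [DecidableEq β] (f : α → β)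
    (σ : Equiv.Perm α) (i : β) :
    Fintype.card {a // (f ∘ σ) a = i} = Fintype.card {a // f a = i} :=
  Fintype.card_congr (σ.subtypeEquiv fun _ => Iff.rfl)

namespace Words

variable {r n : ℕ} {k : Tuples r n}

/-- The action of a permutation of the positions on words. -/
def perm (σ : Equiv.Perm (Fin n)) : Equiv.Perm (Words k) where
  toFun e := ⟨e.1 ∘ ⇑σ⁻¹, fun i => (card_fiber_comp_perm _ _ i).trans (e.2 i)⟩
  invFun e := ⟨e.1 ∘ σ, fun i => (card_fiber_comp_perm _ _ i).trans (e.2 i)⟩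
  left_inv e := Subtype.ext (funext fun j => by simp)
  right_inv e := Subtype.ext (funext fun j => by simp)

theorem exists_perm_eq (e e' : Words k) : ∃ σ : Equiv.Perm (Fin n), perm σ e = e' := by
  obtain ⟨σ, hσ⟩ := exists_perm_comp_eq (f := e'.1) (g := e.1) fun i => (e'.2 i).trans (e.2 i).symm
  exact ⟨σ⁻¹, Subtype.ext (by simpa [perm] using hσ)⟩

/-- Orbit counting: S_n is partitioned by the word to which it sends `e₀`, and each fibre is a coset
of the stabilizer of `e₀`, of order ∏ k_i!. -/
theorem card_mul_prod_factorial (e₀ : Words k) :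
    Fintype.card (Words k) * ∏ i, (k.1 i).factorial = n.factorial := by
  classical
  have hfib : ∀ e : Words k, (Finset.univ.filter fun σ : Equiv.Perm (Fin n) =>
      perm σ⁻¹ e₀ = e).card = ∏ i, (k.1 i).factorial := by
    intro e
    obtain ⟨τ, hτ⟩ := exists_perm_eq e₀ e
    have h := DomMulAct.stabilizer_card e₀.1
    simp only [e₀.2] at h
    rw [← h, ← Fintype.card_subtype]
    refine Fintype.card_congr ((Equiv.mulRight τ).subtypeEquiv fun σ => ?_)
    rw [← hτ]
    constructor
    · intro h
      have h1 : e₀.1 ∘ σ = e₀.1 ∘ ⇑τ⁻¹ := congrArg Subtype.val h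
      funext j
      simpa using congrFun h1 (τ j)
    · intro h
      refine Subtype.ext (funext fun j => ?_)
      simpa [perm] using congrFun h (τ⁻¹ j)
  have h := Finset.card_eq_sum_card_fiberwise (s := (Finset.univ : Finset (Equiv.Perm (Fin n))))
    (t := (Finset.univ : Finset (Words k))) (f := fun σ => perm σ⁻¹ e₀) (fun _ _ => by simp)
  rw [Finset.sum_congr rfl fun e _ => hfib e] at h
  simpa [Fintype.card_perm] using h.symm

theorem card_eq_multinomial (e₀ : Words k) :
    Fintype.card (Words k) = Nat.multinomial Finset.univ k.1 := by
  have h := Nat.multinomial_spec (Finset.univ) k.1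
  rw [k.2, ← card_mul_prod_factorial e₀, mul_comm] at h
  exact (Nat.eq_of_mul_eq_mul_right
    (Finset.prod_pos fun i _ => Nat.factorial_pos _) h).symm

end Words

theorem count_psi {r : ℕ} (k : Fin r → ℕ) (i : Fin r) : (psi k).count (i : ℕ) = k i := by
  rw [psi, List.count_flatMap]
  simp only [Function.comp_def, List.count_replicate]
  rw [← List.ofFn_eq_map, List.sum_ofFn]
  simp [Fin.val_inj]

theorem psiTuple_lt {r n : ℕ} (k : Tuples r n) (j : Fin n) : psiTuple k j < r := by
  have h : psiTuple k j ∈ psi k.1 := List.get_mem _ _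
  simp only [psi, List.mem_flatMap, List.mem_replicate] at h
  obtain ⟨i, -, -, hi⟩ := h
  exact hi ▸ i.2

/-- The weakly increasing word. -/
def baseWord {r n : ℕ} (k : Tuples r n) : Words k :=
  ⟨fun j => ⟨psiTuple k j, psiTuple_lt k j⟩, fun i => by
    have h := Fin.card_filter_univ_eq_vector_get_eq_count (i : ℕ)
      (⟨psi k.1, length_psi k⟩ : List.Vector ℕ n)
    rw [Fintype.card_subtype, ← count_psi k.1 i]
    refine Eq.trans (congrArg Finset.card (Finset.filter_congr fun j _ => ?_)) h
    rw [Fin.ext_iff]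
    rfl⟩

/-! ### Rotating the letters of a word by Γ_k -/

theorem finRotate_pow_val {r : ℕ} (m : ℕ) (i : Fin r) :
    (((finRotate r ^ m) i : Fin r) : ℕ) = (i + m) % r := by
  cases r with
  | zero => exact i.elim0
  | succ r =>
    induction m with
    | zero => simp [Nat.mod_eq_of_lt i.2]
    | succ m ih =>
      rw [pow_succ', Equiv.Perm.mul_apply, finRotate_apply, Fin.val_add, ih, Fin.val_one',
        ← Nat.add_mod, add_assoc]

theorem mem_Gam_iff {r d : ℕ} {γ : Equiv.Perm (Fin r)} :
    γ ∈ Gam r d ↔ ∃ t : ℕ, ∀ i, (γ i : ℕ) = (i + r / d * t) % r := by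
  rw [Gam, ← mem_powers_iff_mem_zpowers, Submonoid.mem_powers_iff]
  refine exists_congr fun t => ?_
  rw [← pow_mul]
  constructor
  · rintro rfl i
    exact finRotate_pow_val _ i
  · intro h
    ext i
    rw [h, finRotate_pow_val]

/-- Elements of Γ are translations modulo r, so one value determines them. This is what makes the
action on nonempty words free. -/
theorem Gam_eq_of_apply_eq {r d : ℕ} {γ γ' : Equiv.Perm (Fin r)} (hγ : γ ∈ Gam r d)
    (hγ' : γ' ∈ Gam r d) {i : Fin r} (h : γ i = γ' i) : γ = γ' := by
  obtain ⟨t, ht⟩ := mem_Gam_iff.1 hγ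
  obtain ⟨t', ht'⟩ := mem_Gam_iff.1 hγ'
  have h1 : (i + r / d * t : ℕ) ≡ i + r / d * t' [MOD r] := by
    rw [Nat.ModEq, ← ht, ← ht', h]
  have h2 := Nat.ModEq.add_left_cancel' _ h1
  ext j
  rw [ht, ht']
  exact h2.add_left _

/-- The action of the stabilizer `Γ_k` on words with letter multiplicities `k`. -/
def rotateWord {r n : ℕ} {d : ℕ} {k : Tuples r n} (γ : gamStab d k) (e : Words k) : Words k :=
  ⟨γ.1.1 ∘ e.1, fun i => by
    have hk : k.1 (γ.1.1⁻¹ i) = k.1 i := congrFun (congrArg Subtype.val γ.2) i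
    rw [← hk, ← e.2]
    refine Fintype.card_congr (Equiv.subtypeEquivRight fun j => ?_)
    rw [Function.comp_apply, Equiv.Perm.eq_inv_iff_eq]⟩

theorem rotateWord_injective {r n d : ℕ} (hn : 1 ≤ n) {k : Tuples r n} (e : Words k) :
    Function.Injective fun γ : gamStab d k => rotateWord γ e := fun γ γ' h =>
  Subtype.ext (Subtype.ext (Gam_eq_of_apply_eq γ.1.2 γ'.1.2
    (congrFun (congrArg Subtype.val h) ⟨0, hn⟩)))

/-- Both words have multiplicities `k`, so a rotation taking one to the other fixes `k`
automatically. -/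
theorem exists_rotateWord_eq {r n d : ℕ} {k : Tuples r n} (e e' : Words k) (t : ℕ)
    (h : ∀ j, (e'.1 j : ℕ) ≡ e.1 j + r / d * t [MOD r]) :
    ∃ γ : gamStab d k, rotateWord γ e = e' := by
  let γ : Gam r d := ⟨(finRotate r ^ (r / d)) ^ t, Subgroup.npow_mem_zpowers _ _⟩
  have hγ : ∀ j, γ.1 (e.1 j) = e'.1 j := fun j => Fin.ext <| by
    change (((finRotate r ^ (r / d)) ^ t) (e.1 j) : ℕ) = _
    rw [← pow_mul, finRotate_pow_val, ← h j, Nat.mod_eq_of_lt (e'.1 j).2]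
  have hst : γ ∈ gamStab d k := by
    refine Subtype.ext (funext fun i => ?_)
    change k.1 (γ.1⁻¹ i) = k.1 i
    rw [← e.2, ← e'.2]
    refine Fintype.card_congr (Equiv.subtypeEquivRight fun j => ?_)
    rw [← hγ, Equiv.Perm.eq_inv_iff_eq]
  exact ⟨⟨γ, hst⟩, Subtype.ext (funext hγ)⟩

/-! ### Word monomials as a basis of V^k -/

open MvPolynomial

variable {r n : ℕ}

/-- The monomial `x_1^{e_1} ⋯ x_n^{e_n}` of a word `e`. -/
noncomputable def wordMonomial (e : Fin n → Fin r) : MvPolynomial (Fin n) ℂ :=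
  permMonomial (fun j => (e j : ℕ)) 1

theorem wordMonomial_eq_monomial (e : Fin n → Fin r) :
    wordMonomial e = monomial (Finsupp.equivFunOnFinite.symm fun j => (e j : ℕ)) 1 := by
  rw [monomial_eq, Finsupp.prod_fintype _ _ (fun _ => by simp)]
  simp [wordMonomial, permMonomial]

theorem linearIndependent_wordMonomial :
    LinearIndependent ℂ (wordMonomial : (Fin n → Fin r) → MvPolynomial (Fin n) ℂ) := by
  have h := (basisMonomials (Fin n) ℂ).linearIndependent.comp
    (fun e : Fin n → Fin r => Finsupp.equivFunOnFinite.symm fun j => (e j : ℕ)) fun e e' h =>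
      funext fun j => Fin.ext (DFunLike.congr_fun h j)
  have hfun : (wordMonomial : (Fin n → Fin r) → MvPolynomial (Fin n) ℂ) =
      basisMonomials (Fin n) ℂ ∘ fun e => Finsupp.equivFunOnFinite.symm fun j => (e j : ℕ) :=
    funext fun e => by
      rw [wordMonomial_eq_monomial, Function.comp_apply, coe_basisMonomials]
  rw [hfun]
  exact h

theorem permMonomial_eq_wordMonomial (e : Fin n → Fin r) (σ : Equiv.Perm (Fin n)) :
    permMonomial (fun j => (e j : ℕ)) σ = wordMonomial (e ∘ ⇑σ⁻¹) := by
  simp only [permMonomial, wordMonomial]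
  rw [← Equiv.prod_comp σ fun i =>
    (X ((1 : Equiv.Perm (Fin n)) i) : MvPolynomial (Fin n) ℂ) ^ ((e ∘ ⇑σ⁻¹) i : ℕ)]
  simp

open Classical in
theorem monomials_psiTuple (k : Tuples r n) :
    monomials (psiTuple k) = Finset.univ.image fun e : Words k => wordMonomial e.1 := by
  have hb : psiTuple k = fun j => (((baseWord k).1 j : Fin r) : ℕ) := rfl
  ext f
  simp only [monomials, Finset.mem_image, Finset.mem_univ, true_and]
  constructor
  · rintro ⟨σ, rfl⟩
    exact ⟨Words.perm σ (baseWord k), by rw [hb, permMonomial_eq_wordMonomial]; rfl⟩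
  · rintro ⟨e, rfl⟩
    obtain ⟨σ, rfl⟩ := Words.exists_perm_eq (baseWord k) e
    exact ⟨σ, by rw [hb, permMonomial_eq_wordMonomial]; rfl⟩

/-- The monomial of a word, as an element of `V^k`. -/
noncomputable def wordVec {k : Tuples r n} (e : Words k) : (V k).toSubmodule :=
  ⟨wordMonomial e.1, Submodule.subset_span <| by
    classical
    rw [monomials_psiTuple]
    exact Finset.mem_coe.2 (Finset.mem_image_of_mem _ (Finset.mem_univ e))⟩

theorem linearIndependent_wordVec (k : Tuples r n) :
    LinearIndependent ℂ (wordVec : Words k → (V k).toSubmodule) :=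
  LinearIndependent.of_comp (V k).toSubmodule.subtype
    (linearIndependent_wordMonomial.comp _ Subtype.val_injective)

theorem w_eq_sum (k : Tuples r n) : w k = ∑ e, wordVec e := by
  classical
  refine Subtype.ext ?_
  rw [AddSubmonoidClass.coe_finsetSum]
  change ∑ f ∈ monomials (psiTuple k), f = _
  rw [monomials_psiTuple, Finset.sum_image]
  · rfl
  · exact fun e _ e' _ h => Subtype.ext (linearIndependent_wordMonomial.injective h)

theorem w_ne_zero (k : Tuples r n) : w k ≠ 0 := by
  rw [w_eq_sum]
  exact sum_ne_zero_of_linearIndependent (linearIndependent_wordVec k)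
    ⟨baseWord k, Finset.mem_univ _⟩

theorem finrank_V (k : Tuples r n) :
    Module.finrank ℂ (V k).toSubmodule = Fintype.card (Words k) := by
  classical
  have h : (V k).toSubmodule = Submodule.span ℂ (Set.range fun e : Words k => wordMonomial e.1) := by
    change Submodule.span ℂ (monomials (psiTuple k) : Set (MvPolynomial (Fin n) ℂ)) = _
    rw [monomials_psiTuple, Finset.coe_image, Finset.coe_univ, Set.image_univ]
  rw [h]
  exact finrank_span_eq_card (linearIndependent_wordMonomial.comp _ Subtype.val_injective)

instance (k : Tuples r n) : FiniteDimensional ℂ (V k).toSubmodule :=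
  FiniteDimensional.span_finset ℂ _

theorem polyRep_wordMonomial (g : FullGroup r n) (e : Fin n → Fin r) :
    polyRep r n g (wordMonomial e) =
      (∏ j, (((g.left (g.right j) : ℂˣ) : ℂ)⁻¹) ^ (e j : ℕ)) •
        wordMonomial (e ∘ ⇑g.right⁻¹) := by
  rw [wordMonomial, polyRep_permMonomial, mul_one, permMonomial_eq_wordMonomial]
  rfl

/-! ### Characters of the diagonal subgroup and their fibres -/

variable (r n) in
/-- The group of diagonal elements of `G(r,d,n)`. -/
def diagGroup (d : ℕ) : Subgroup (Fin n → rootsOfUnity r ℂ) :=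
  ((Phi r d n).comp SemidirectProduct.inl).ker

theorem mem_diagGroup {d : ℕ} {z : Fin n → rootsOfUnity r ℂ} :
    z ∈ diagGroup r n d ↔ (∏ i, z i) ^ (r / d) = 1 := Iff.rfl

variable (r n) in
/-- The inclusion of the diagonal elements in `G(r,d,n)`. -/
def diagIncl (d : ℕ) : diagGroup r n d →* reflGroup r d n :=
  (SemidirectProduct.inl.comp (diagGroup r n d).subtype).codRestrict _ fun z => z.2

variable (n) in
/-- The inclusion of the symmetric group in `G(r,d,n)`. -/
def permIncl (r d : ℕ) (σ : Equiv.Perm (Fin n)) : reflGroup r d n :=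
  ⟨SemidirectProduct.inr σ, by
    change (∏ i, (1 : Fin n → rootsOfUnity r ℂ) i) ^ (r / d) = 1
    simp⟩

/-- The monomial character with exponents `e`. -/
def monomialChar (e : Fin n → ℕ) : (Fin n → rootsOfUnity r ℂ) →* rootsOfUnity r ℂ where
  toFun z := ∏ j, z j ^ e j
  map_one' := by simp
  map_mul' z z' := by simp [mul_pow, Finset.prod_mul_distrib]

variable (r) in
/-- The embedding of the roots of unity in `ℂ`, composed with inversion. -/
def invRoot : rootsOfUnity r ℂ →* ℂ :=
  ((Units.coeHom ℂ).comp (rootsOfUnity r ℂ).subtype).comp invMonoidHom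

theorem invRoot_injective : Function.Injective (invRoot r) := fun _ _ h =>
  inv_injective (Subtype.ext (Units.ext h))

/-- The character by which the diagonal elements of `G(r,d,n)` act on the monomial of a word. -/
def wordChar (d : ℕ) {k : Tuples r n} (e : Words k) : diagGroup r n d →* ℂ :=
  ((invRoot r).comp (monomialChar fun j => e.1 j)).comp (diagGroup r n d).subtype

theorem resV_diag {d : ℕ} {k : Tuples r n} (z : diagGroup r n d) (e : Words k) :
    resV d k (diagIncl r n d z) (wordVec e) = wordChar d e z • wordVec e := by
  refine Subtype.ext ((polyRep_wordMonomial _ _).trans ?_)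
  change _ = wordChar d e z • wordMonomial e.1
  congr 1
  change ∏ j, (((z.1 j : ℂˣ) : ℂ)⁻¹) ^ (e.1 j : ℕ) =
    (((∏ j, z.1 j ^ (e.1 j : ℕ) : rootsOfUnity r ℂ)⁻¹ : ℂˣ) : ℂ)
  simp

theorem resV_perm {d : ℕ} {k : Tuples r n} (σ : Equiv.Perm (Fin n)) (e : Words k) :
    resV d k (permIncl n r d σ) (wordVec e) = wordVec (Words.perm σ e) := by
  refine Subtype.ext ((polyRep_wordMonomial _ _).trans ?_)
  change _ = wordMonomial (e.1 ∘ ⇑σ⁻¹)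
  simp [permIncl]

theorem resV_perm_sum {d : ℕ} {k : Tuples r n} (σ : Equiv.Perm (Fin n)) :
    resV d k (permIncl n r d σ) (∑ e, wordVec e) = ∑ e, wordVec e := by
  simp only [map_sum, resV_perm]
  exact Equiv.sum_comp (Words.perm σ) wordVec

theorem exists_resV_sum_eq {d : ℕ} {k : Tuples r n} (g : reflGroup r d n) :
    ∃ z, resV d k g (∑ e, wordVec e) = resV d k (diagIncl r n d z) (∑ e, wordVec e) := by
  have hz : g.1.left ∈ diagGroup r n d := g.2
  refine ⟨⟨g.1.left, hz⟩, ?_⟩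
  have hg : g = diagIncl r n d ⟨g.1.left, hz⟩ * permIncl n r d g.1.right :=
    Subtype.ext (SemidirectProduct.inl_left_mul_inr_right g.1).symm
  conv_lhs => rw [hg]
  rw [map_mul, Module.End.mul_apply, resV_perm_sum]

theorem wordChar_eq_iff {d : ℕ} {k : Tuples r n} {e e' : Words k} :
    wordChar d e = wordChar d e' ↔
      ∀ z ∈ diagGroup r n d, ∏ j, z j ^ (e.1 j : ℕ) = ∏ j, z j ^ (e'.1 j : ℕ) :=
  ⟨fun h z hz => invRoot_injective (DFunLike.congr_fun h ⟨z, hz⟩),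
    fun h => MonoidHom.ext fun z => congrArg (invRoot r) (h z.1 z.2)⟩

/-- With p = r/d, shifting all exponents by pt multiplies the character by (∏ z_j)^(pt), which is 1
on the diagonal subgroup; reduction modulo r is harmless for r-th roots of unity. -/
theorem wordChar_rotateWord {d : ℕ} {k : Tuples r n} (γ : gamStab d k) (e : Words k) :
    wordChar d (rotateWord γ e) = wordChar d e := by
  rw [wordChar_eq_iff]
  intro z hz
  obtain ⟨t, ht⟩ := mem_Gam_iff.1 γ.1.2
  have h1 : ∀ x : rootsOfUnity r ℂ, x ^ r = 1 := fun x => Subtype.ext x.2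
  calc ∏ j, z j ^ ((rotateWord γ e).1 j : ℕ)
      = ∏ j, z j ^ ((e.1 j : ℕ) + r / d * t) := Finset.prod_congr rfl fun j _ => by
        rw [pow_eq_pow_mod ((e.1 j : ℕ) + r / d * t) (h1 _), ← ht]; rfl
    _ = ∏ j, z j ^ (e.1 j : ℕ) := by
      simp only [pow_add, Finset.prod_mul_distrib, pow_mul, Finset.prod_pow]
      rw [mem_diagGroup.1 hz, one_pow, mul_one]

/-- For a primitive r-th root ζ, two kinds of diagonal elements suffice as tests. ζ^d at one
position makes the letter difference there a multiple of p = r/d; ζ and ζ⁻¹ at two positions make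
the differences there agree modulo r. The words thus differ by one constant shift in pℤ. -/
theorem exists_rotateWord_of_wordChar_eq {d : ℕ} (hr : 1 ≤ r) (hn : 1 ≤ n) (hd : d ∣ r)
    {k : Tuples r n} {e e' : Words k} (h : wordChar d e = wordChar d e') :
    ∃ γ : gamStab d k, rotateWord γ e = e' := by
  have : NeZero r := ⟨by omega⟩
  rw [wordChar_eq_iff] at h
  obtain ⟨ζ, hζ⟩ : ∃ ζ : rootsOfUnity r ℂ, orderOf ζ = r :=
    ⟨(Complex.isPrimitiveRoot_exp r (by omega)).toRootsOfUnity, by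
      rw [← Subgroup.orderOf_coe, ← orderOf_units]
      exact (Complex.isPrimitiveRoot_exp r (by omega)).eq_orderOf.symm⟩
  have hroot : ∀ x : rootsOfUnity r ℂ, x ^ r = 1 := fun x => Subtype.ext x.2
  have hd0 : 0 < d := Nat.pos_of_dvd_of_pos hd hr
  have hrd : d * (r / d) = r := Nat.mul_div_cancel' hd
  let j₀ : Fin n := ⟨0, hn⟩
  have hprod : ∀ (j : Fin n) (x : rootsOfUnity r ℂ) (m : Fin n → ℕ),
      ∏ i, (Pi.mulSingle j x : Fin n → rootsOfUnity r ℂ) i ^ m i = x ^ m j := fun j x m => by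
    rw [Finset.prod_eq_single j (fun i _ hi => by rw [Pi.mulSingle_eq_of_ne hi, one_pow])
      (by simp), Pi.mulSingle_eq_same]
  have h₀ : (e.1 j₀ : ℕ) ≡ e'.1 j₀ [MOD r / d] := by
    have hz : (Pi.mulSingle j₀ (ζ ^ d) : Fin n → rootsOfUnity r ℂ) ∈ diagGroup r n d := by
      have := hprod j₀ (ζ ^ d) fun _ => 1
      simp only [pow_one] at this
      rw [mem_diagGroup, this, ← pow_mul, hrd]
      exact hroot ζ
    have h2 := h _ hz
    rw [hprod j₀ _ fun j => (e.1 j : ℕ), hprod j₀ _ fun j => (e'.1 j : ℕ), ← pow_mul, ← pow_mul,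
      pow_eq_pow_iff_modEq, hζ] at h2
    have h3 : d * (e.1 j₀ : ℕ) ≡ d * e'.1 j₀ [MOD d * (r / d)] := by rwa [hrd]
    exact Nat.ModEq.mul_left_cancel' hd0.ne' h3
  have hj : ∀ j, (e.1 j + e'.1 j₀ : ℕ) ≡ e'.1 j + e.1 j₀ [MOD r] := by
    intro j
    have hm : ∀ m : Fin n → ℕ, ∏ i, (Pi.mulSingle j ζ * Pi.mulSingle j₀ ζ⁻¹ :
        Fin n → rootsOfUnity r ℂ) i ^ m i = ζ ^ m j * ζ⁻¹ ^ m j₀ := fun m => by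
      simp only [Pi.mul_apply, mul_pow, Finset.prod_mul_distrib, hprod]
    have hz : (Pi.mulSingle j ζ * Pi.mulSingle j₀ ζ⁻¹ : Fin n → rootsOfUnity r ℂ) ∈
        diagGroup r n d := by
      have := hm fun _ => 1
      simp only [pow_one] at this
      rw [mem_diagGroup, this, mul_inv_cancel, one_pow]
    have h2 := h _ hz
    rw [hm fun j => (e.1 j : ℕ), hm fun j => (e'.1 j : ℕ), inv_pow, inv_pow, mul_inv_eq_iff_eq_mul,
      mul_right_comm, eq_mul_inv_iff_mul_eq, ← pow_add, ← pow_add, pow_eq_pow_iff_modEq, hζ] at h2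
    exact h2
  -- Adding r keeps the natural-number subtraction from truncating.
  have hlt : (e.1 j₀ : ℕ) ≤ e'.1 j₀ + r := by omega
  obtain ⟨t, ht⟩ : r / d ∣ e'.1 j₀ + r - e.1 j₀ := by
    refine (Nat.modEq_iff_dvd' hlt).1 (h₀.trans ?_)
    have : r ≡ 0 [MOD r / d] := (Nat.modEq_zero_iff_dvd).2 (Nat.div_dvd_of_dvd hd)
    simpa using (this.add_left (e'.1 j₀ : ℕ)).symm
  refine exists_rotateWord_eq e e' t fun j => ?_
  rw [← ht]
  refine Nat.ModEq.add_right_cancel' (e.1 j₀ : ℕ) ?_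
  rw [add_assoc, Nat.sub_add_cancel hlt, ← add_assoc]
  refine (hj j).symm.trans ?_
  simp [Nat.ModEq]

theorem card_range_wordChar_mul {d : ℕ} (hr : 1 ≤ r) (hn : 1 ≤ n) (hd : d ∣ r)
    (k : Tuples r n) :
    Nat.card (Set.range (wordChar d : Words k → _)) * Nat.card (gamStab d k) =
      Fintype.card (Words k) := by
  have hfib : ∀ χ : Set.range (wordChar d : Words k → _),
      Nonempty ({e : Words k // Set.rangeFactorization (wordChar d) e = χ} ≃ gamStab d k) := by
    rintro ⟨_, e, rfl⟩
    refine ⟨(Equiv.ofBijective (fun γ => ⟨rotateWord γ e,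
      Subtype.ext (wordChar_rotateWord γ e)⟩) ⟨fun γ γ' h => ?_, ?_⟩).symm⟩
    · exact rotateWord_injective hn e (congrArg Subtype.val h)
    · rintro ⟨e', he'⟩
      obtain ⟨γ, hγ⟩ := exists_rotateWord_of_wordChar_eq hr hn hd (congrArg Subtype.val he').symm
      exact ⟨γ, Subtype.ext hγ⟩
  rw [← Nat.card_prod, ← Nat.card_eq_fintype_card]
  exact Nat.card_congr (((Equiv.sigmaFiberEquiv _).symm.trans
    (Equiv.sigmaCongrRight fun χ => (hfib χ).some)).trans (Equiv.sigmaEquivProd _ _)).symm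

/-! ### Irreducibility and dimension of W^k -/

theorem W_eq_span (d : ℕ) (k : Tuples r n) : (W d k).toSubmodule =
    Submodule.span ℂ (Set.range fun g => resV d k g (∑ e, wordVec e)) := by
  rw [← w_eq_sum]
  rfl

theorem w_mem_W (d : ℕ) (k : Tuples r n) : w k ∈ (W d k).toSubmodule :=
  Submodule.subset_span ⟨1, by simp⟩

theorem finite_reflGroup [NeZero r] (d : ℕ) : Finite (reflGroup r d n) := by
  have : Finite (FullGroup r n) := Finite.of_equiv _ SemidirectProduct.equivProd.symm
  infer_instance

theorem isIrreducible_W {d : ℕ} (hr : 1 ≤ r) (k : Tuples r n) :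
    Representation.IsIrreducible (k := ℂ) (V := (W d k).toSubmodule) (W d k).toRepresentation := by
  have : NeZero r := ⟨by omega⟩
  have := Fintype.ofFinite (diagGroup r n d)
  have hnt : Nontrivial (Subrepresentation (W d k).toRepresentation) := by
    refine ⟨⊥, ⊤, fun h => w_ne_zero k ?_⟩
    have h1 : (⟨w k, w_mem_W d k⟩ : (W d k).toSubmodule) ∈
        (⊥ : Subrepresentation (W d k).toRepresentation) := h ▸ Submodule.mem_top
    exact congrArg Subtype.val ((Submodule.mem_bot ℂ).1 h1)
  refine ⟨fun S => ?_⟩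
  rw [or_iff_not_imp_left]
  intro hS
  -- The criterion concerns invariant subspaces of `V k`, so `S` is pushed forward along the
  -- injective inclusion of W.
  let U := S.toSubmodule.map (W d k).toSubmodule.subtype
  have hUW : U = (W d k).toSubmodule := by
    rw [W_eq_span]
    refine eq_of_le_span_orbit (linearIndependent_wordVec k) resV_diag exists_resV_sum_eq
      (fun e e' => ?_) ?_ ?_ ?_
    · obtain ⟨σ, hσ⟩ := Words.exists_perm_eq e e'
      exact ⟨permIncl n r d σ, Words.perm σ, resV_perm σ, hσ⟩
    · rintro g _ ⟨x, hx, rfl⟩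
      exact ⟨_, S.apply_mem_toSubmodule g hx, rfl⟩
    · rw [← W_eq_span]
      exact Submodule.map_subtype_le _ _
    · intro hU
      refine hS (Subrepresentation.toSubmodule_injective ?_)
      refine Submodule.map_injective_of_injective (W d k).toSubmodule.injective_subtype ?_
      exact hU.trans (Submodule.map_bot _).symm
  refine Subrepresentation.toSubmodule_injective ?_
  refine Submodule.map_injective_of_injective (W d k).toSubmodule.injective_subtype ?_
  exact hUW.trans (Submodule.map_subtype_top _).symm

theorem resV_w_of_mem_symSubgroup {d : ℕ} {k : Tuples r n} {s : reflGroup r d n}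
    (hs : s ∈ symSubgroup r d n) : resV d k s (w k) = w k := by
  obtain ⟨σ, hσ⟩ := hs
  rw [show s = permIncl n r d σ from Subtype.ext hσ.symm, w_eq_sum, resV_perm_sum]

theorem finrank_W_mul {d : ℕ} (hr : 1 ≤ r) (hn : 1 ≤ n) (hd : d ∣ r) (k : Tuples r n) :
    Module.finrank ℂ (W d k).toSubmodule * Nat.card (gamStab d k) = Fintype.card (Words k) := by
  have : NeZero r := ⟨by omega⟩
  have := Fintype.ofFinite (diagGroup r n d)
  rw [W_eq_span, finrank_span_orbit (linearIndependent_wordVec k) resV_diag exists_resV_sum_eq,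
    card_range_wordChar_mul hr hn hd]

end ComplexReflection

theorem mainTheorem2 (r d n : ℕ) (hr : 1 ≤ r) (hn : 1 ≤ n) (hd : d ∣ r)
    (k : ComplexReflection.Tuples r n) :
    (∀ s ∈ ComplexReflection.symSubgroup r d n,
      ComplexReflection.resV d k s (ComplexReflection.w k) = ComplexReflection.w k) ∧
    Representation.IsIrreducible (k := ℂ) (V := (ComplexReflection.W d k).toSubmodule)
      (ComplexReflection.W d k).toRepresentation ∧
    (∃ f : Representation.IntertwiningMap (ComplexReflection.W d k).toRepresentation
        (ComplexReflection.indTriv r d n), Function.Injective f) ∧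
    (Module.finrank ℂ (ComplexReflection.W d k).toSubmodule : ℚ) =
      (Module.finrank ℂ (ComplexReflection.V k).toSubmodule : ℚ) /
        (Nat.card (ComplexReflection.gamStab d k) : ℚ) ∧
    (Module.finrank ℂ (ComplexReflection.W d k).toSubmodule : ℚ) =
      (Nat.card (ComplexReflection.gamStab d k) : ℚ)⁻¹ *
        (Nat.multinomial Finset.univ k.1 : ℚ) := by
  have : NeZero r := ⟨by omega⟩
  have := ComplexReflection.finite_reflGroup (n := n) (r := r) d
  have hirr := ComplexReflection.isIrreducible_W (d := d) hr k
  have hfin := ComplexReflection.finrank_W_mul hr hn hd k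
  have hcard : (Nat.card (ComplexReflection.gamStab d k) : ℚ) ≠ 0 :=
    Nat.cast_ne_zero.2 Nat.card_pos.ne'
  have hdim : (Module.finrank ℂ (ComplexReflection.W d k).toSubmodule : ℚ) =
      (Module.finrank ℂ (ComplexReflection.V k).toSubmodule : ℚ) /
        (Nat.card (ComplexReflection.gamStab d k) : ℚ) := by
    rw [eq_div_iff hcard, ComplexReflection.finrank_V, ← hfin, Nat.cast_mul]
  refine ⟨fun s hs => ComplexReflection.resV_w_of_mem_symSubgroup hs, hirr, ?_, hdim, ?_⟩
  · refine ComplexReflection.exists_injective_intertwiningMap_ind (K := ℂ)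
      (V := (ComplexReflection.W d k).toSubmodule)
      (ComplexReflection.W d k).toRepresentation (ComplexReflection.symSubgroup r d n)
      (v := ⟨ComplexReflection.w k, ComplexReflection.w_mem_W d k⟩)
      (fun h => ComplexReflection.w_ne_zero k (congrArg Subtype.val h)) fun s hs => ?_
    exact Subtype.ext (ComplexReflection.resV_w_of_mem_symSubgroup hs)
  · rw [hdim, ComplexReflection.finrank_V,
      ComplexReflection.Words.card_eq_multinomial (ComplexReflection.baseWord k), div_eq_inv_mul]
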